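/- For a nonnegative integer $N$ put $(a;q)_N=\prod_{r=0}^{N-1}(1-aq^r)$, for an integer $n$ put $T_n=n(n+1)/2$, and for integers $a,b$ let the $q$-binomial coefficient be the polynomial in $q$ $$\begin{bmatrix} a\\ b\end{bmatrix}_q=\frac{(q;q)_a}{(q;q)_b\,(q;q)_{a-b}}\ \text{ if } 0\le b\le a,\qquad \begin{bmatrix} a\\ b\end{bmatrix}_q=0\ \text{ otherwise.}$$ Then for every integer $L\ge 0$ the following identity between polynomials in $z$ and $q$ holds (equivalently, it holds for all elements $q,z$ of every commutative ring, each $q$-binomial coefficient being the value of the above polynomial at $q$); on both sides only finitely many terms are nonzero: $$\sum_{j\ge 0}(z^2q^2;q^2)_j\,q^{T_{L-2j-1}}\begin{bmatrix} L+1\\ 2j+1\end{bmatrix}_q=\sum_{i,j,k\ge 0}(-1)^j z^{i+j}q^{T_i+T_j+T_k}\begin{bmatrix} L-i\\ j\end{bmatrix}_q\begin{bmatrix} L-j\\ k\end{bmatrix}_q\begin{bmatrix} L-k\\ i\end{bmatrix}_q .$$ -/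

import Mathlib

open Polynomial

/-- The finite `q`-shifted factorial `(a; q)_N = ∏_{j=0}^{N-1} (1 - a q^j)`,
equal to `1` for `N = 0`. -/
def qPoch {R : Type*} [CommRing R] (a q : R) (N : ℕ) : R :=
  ∏ j ∈ Finset.range N, (1 - a * q ^ j)

/-- The triangular number `T_n = n (n + 1) / 2`, for every integer `n`. The product
`n (n + 1)` is even and nonnegative, so neither the division nor `Int.toNat` loses anything. -/
def triangular (n : ℤ) : ℕ := (n * (n + 1) / 2).toNat

/-- `(X^N - 1) ⋯ (X^2 - 1) (X - 1) = (-1)^N (X; X)_N`, the monic associate of `(X; X)_N`. -/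
noncomputable def monicPoch (N : ℕ) : ℤ[X] :=
  ∏ j ∈ Finset.range N, (X ^ (j + 1) - 1)

/-- The Gaussian polynomial `(X; X)_{n+m} / ((X; X)_n (X; X)_m)` in `ℤ[X]`. The signs
`(-1)^{n+m}`, `(-1)^n`, `(-1)^m` of the monic associates cancel. The division is exact
(see `gaussPoly_mul`). -/
noncomputable def gaussPoly (n m : ℕ) : ℤ[X] :=
  monicPoch (n + m) /ₘ (monicPoch n * monicPoch m)

/-- The `q`-binomial coefficient `[a choose b]_q` at an element `q` of a commutative ring, for
integers `a`, `b`: with `b = n` and `a = n + m` it is the value at `q` of the polynomial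
`(q; q)_{n+m} / ((q; q)_n (q; q)_m)` if `n, m ≥ 0`, and `0` otherwise. -/
noncomputable def qBinom {R : Type*} [CommRing R] (q : R) (a b : ℤ) : R :=
  if 0 ≤ b ∧ 0 ≤ a - b then aeval q (gaussPoly b.toNat (a - b).toNat) else 0

theorem monicPoch_monic (N : ℕ) : (monicPoch N).Monic :=
  monic_prod_of_monic _ _ fun j _ => by
    simpa using monic_X_pow_sub_C (1 : ℤ) (Nat.succ_ne_zero j)

theorem monicPoch_succ (N : ℕ) : monicPoch (N + 1) = monicPoch N * (X ^ (N + 1) - 1) :=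
  Finset.prod_range_succ _ _

theorem monicPoch_dvd (n m : ℕ) : monicPoch n * monicPoch m ∣ monicPoch (n + m) := by
  induction n generalizing m with
  | zero => simp [monicPoch]
  | succ n ihn =>
    induction m with
    | zero => simp [monicPoch]
    | succ m ihm =>
      have h1 : monicPoch (n + 1) * monicPoch (m + 1) ∣
          monicPoch (n + (m + 1)) * (X ^ (n + 1) - 1) := by
        have h := mul_dvd_mul_right (ihn (m + 1)) (X ^ (n + 1) - 1 : ℤ[X])
        rw [monicPoch_succ n]
        convert h using 1
        ring
      have h2 : monicPoch (n + 1) * monicPoch (m + 1) ∣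
          monicPoch (n + (m + 1)) * (X ^ (m + 1) - 1) := by
        have h := mul_dvd_mul_right ihm (X ^ (m + 1) - 1 : ℤ[X])
        rw [monicPoch_succ m, ← mul_assoc]
        convert h using 2
        congr 1
        ring
      have e : monicPoch (n + 1 + (m + 1)) =
          monicPoch (n + (m + 1)) * (X ^ (n + 1) - 1) * X ^ (m + 1) +
            monicPoch (n + (m + 1)) * (X ^ (m + 1) - 1) := by
        rw [show n + 1 + (m + 1) = n + (m + 1) + 1 by ring, monicPoch_succ]
        ring
      rw [e]
      exact dvd_add (h1.mul_right _) h2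

/-- The division that defines `gaussPoly` is exact. -/
theorem gaussPoly_mul (n m : ℕ) :
    gaussPoly n m * (monicPoch n * monicPoch m) = monicPoch (n + m) := by
  have hm : (monicPoch n * monicPoch m).Monic := (monicPoch_monic n).mul (monicPoch_monic m)
  have h := modByMonic_add_div (monicPoch (n + m)) (monicPoch n * monicPoch m)
  rw [(modByMonic_eq_zero_iff_dvd hm).2 (monicPoch_dvd n m), zero_add, mul_comm] at h
  exact h

theorem aeval_monicPoch {R : Type*} [CommRing R] (q : R) (N : ℕ) :
    aeval q (monicPoch N) = (-1) ^ N * qPoch q q N := by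
  induction N with
  | zero => simp [monicPoch, qPoch]
  | succ N ih =>
    rw [monicPoch_succ, map_mul, ih, qPoch, qPoch, Finset.prod_range_succ]
    simp only [map_sub, map_pow, aeval_X, map_one]
    ring

/-- The `q`-binomial coefficient times `(q; q)_n (q; q)_m` is `(q; q)_{n+m}`. -/
theorem qBinom_mul {R : Type*} [CommRing R] (q : R) (n m : ℕ) :
    qBinom q (n + m) n * (qPoch q q n * qPoch q q m) = qPoch q q (n + m) := by
  have h := congrArg (aeval q) (gaussPoly_mul n m)
  rw [map_mul, map_mul, aeval_monicPoch, aeval_monicPoch, aeval_monicPoch] at h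
  have hq : qBinom q (n + m) n = aeval q (gaussPoly n m) := by simp [qBinom]
  rw [hq]
  have hs : ((-1 : R) ^ (n + m)) * (-1) ^ (n + m) = 1 := by
    rw [← mul_pow]; simp
  have h' := congrArg (fun x => (-1 : R) ^ (n + m) * x) h
  simp only [← mul_assoc, hs, one_mul] at h'
  rw [← h']
  linear_combination (-(aeval q (gaussPoly n m)) * qPoch q q n * qPoch q q m) * hs

/-- Over a field, the `q`-binomial coefficient is the usual quotient whenever the denominator
does not vanish. -/
theorem qBinom_eq_div {K : Type*} [Field K] (q : K) (n m : ℕ)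
    (h : qPoch q q n * qPoch q q m ≠ 0) :
    qBinom q (n + m) n = qPoch q q (n + m) / (qPoch q q n * qPoch q q m) :=
  eq_div_of_mul_eq h (qBinom_mul q n m)

/-- The summand `(z^2 q^2; q^2)_j q^{T_{L-2j-1}} [L+1 choose 2j+1]_q`. -/
noncomputable def singleTerm {R : Type*} [CommRing R] (q z : R) (L j : ℕ) : R :=
  qPoch (z ^ 2 * q ^ 2) (q ^ 2) j * q ^ triangular ((L : ℤ) - 2 * j - 1) *
    qBinom q ((L : ℤ) + 1) (2 * j + 1)

/-- The summand
`(-1)^j z^{i+j} q^{T_i+T_j+T_k} [L-i choose j]_q [L-j choose k]_q [L-k choose i]_q`. -/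
noncomputable def tripleTerm {R : Type*} [CommRing R] (q z : R) (L i j k : ℕ) : R :=
  (-1) ^ j * z ^ (i + j) * q ^ (triangular i + triangular j + triangular k) *
    qBinom q ((L : ℤ) - i) j * qBinom q ((L : ℤ) - j) k * qBinom q ((L : ℤ) - k) i

/-! Both sides are polynomial in `q` and `z`, so it suffices to treat the fraction field of `ℤ[q,
z]`, where no `1 - q^n` with `n ≥ 1` vanishes and `q`-binomials are quotients of `q`-factorials.
There both sides equal `∑ m, commonTerm q z L m`, an expansion in powers of `z²`.

Single sum (`sum_singleTerm`): the `q`-binomial theorem in base `q²` expands `(z²q²; q²)_j` over `j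
= m + l`. At fixed `m`, the sum over `l` is the `q`-Gauss sum `sum_range_qGauss`.

Triple sum (`sum_tripleTerm`): `q`-Chu–Vandermonde with parameter `L - k` introduces an index `t`
that decouples `k` from the factor `(q; q)_{L-k}`. The sum over `k` is then a `q`-binomial sum at `x
= -1`. With `i = r + t`, `j = u + t`, the sum over `r + u = w` is `sum_antidiagonal_wellPoised`; it
vanishes for odd `w`, so only even powers of `z` survive. For `w = 2n` and `m = t + n`, the
remaining sum over `t` is `sum_antidiagonal_neg_one_pow_mul_sq`. -/

/-! ### Triangular numbers and `q`-shifted factorials. -/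

theorem two_mul_triangular (n : ℕ) : 2 * triangular (n : ℤ) = n * (n + 1) := by
  obtain ⟨k, hk⟩ := Nat.even_mul_succ_self n
  have h : (n : ℤ) * (n + 1) = 2 * k := by
    have := congrArg (Nat.cast : ℕ → ℤ) hk
    push_cast at this
    rw [this]; ring
  rw [triangular, h, Int.mul_ediv_cancel_left _ (by norm_num), Int.toNat_natCast]
  have : n * (n + 1) = k + k := hk
  omega

theorem triangular_zero : triangular 0 = 0 := rfl

theorem triangular_neg_one : triangular (-1) = 0 := rfl

theorem triangular_add (m n : ℕ) :
    triangular ((m : ℤ) + n) = triangular m + triangular n + m * n := by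
  have h1 := two_mul_triangular (m + n)
  have h2 := two_mul_triangular m
  have h3 := two_mul_triangular n
  push_cast at h1
  nlinarith

theorem triangular_succ (n : ℕ) : triangular ((n : ℤ) + 1) = triangular n + (n + 1) := by
  have h := triangular_add n 1
  rw [Nat.cast_one] at h
  rw [h, show triangular 1 = 1 from rfl]
  ring

theorem triangular_sub_one (n : ℕ) : triangular (n : ℤ) = triangular ((n : ℤ) - 1) + n := by
  cases n with
  | zero => rfl
  | succ n => rw [Nat.cast_succ, triangular_succ, add_sub_cancel_right]

theorem qPoch_zero {R : Type*} [CommRing R] (a q : R) : qPoch a q 0 = 1 := by simp [qPoch]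

theorem qPoch_succ {R : Type*} [CommRing R] (a q : R) (n : ℕ) :
    qPoch a q (n + 1) = qPoch a q n * (1 - a * q ^ n) := Finset.prod_range_succ _ _

theorem qPoch_self_succ {R : Type*} [CommRing R] (q : R) (n : ℕ) :
    qPoch q q (n + 1) = qPoch q q n * (1 - q ^ (n + 1)) := by
  rw [qPoch_succ, pow_succ']

theorem qPoch_neg_mul {R : Type*} [CommRing R] (q : R) (n : ℕ) :
    qPoch (-q) q n * qPoch q q n = qPoch (q ^ 2) (q ^ 2) n := by
  induction n with
  | zero => simp [qPoch_zero]
  | succ n ih => rw [qPoch_succ, qPoch_succ, qPoch_succ, ← ih]; ring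

theorem qPoch_two_mul_add_one {R : Type*} [CommRing R] (q : R) (n : ℕ) :
    qPoch q q (2 * n + 1) = qPoch q (q ^ 2) (n + 1) * qPoch (q ^ 2) (q ^ 2) n := by
  induction n with
  | zero => simp [qPoch_zero, qPoch_succ]
  | succ n ih =>
    rw [show 2 * (n + 1) + 1 = 2 * n + 1 + 1 + 1 by ring, qPoch_self_succ, qPoch_self_succ, ih,
      qPoch_succ q _ (n + 1), qPoch_self_succ (q ^ 2)]
    ring

/-! ### Reciprocals of `q`-factorials for generic `q`. -/

section Field

variable {K : Type*} [Field K] {q : K}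

/-- The reciprocal `1 / (q; q)_n`, extended by zero to the negative integers. -/
noncomputable def invPoch (q : K) (n : ℤ) : K :=
  if 0 ≤ n then (qPoch q q n.toNat)⁻¹ else 0

/-- No positive power of `q` equals `1`. -/
def QGeneric (q : K) : Prop := ∀ n : ℕ, 1 - q ^ (n + 1) ≠ 0

theorem QGeneric.sq (hq : QGeneric q) : QGeneric (q ^ 2) := fun n => by
  rw [← pow_mul, show 2 * (n + 1) = 2 * n + 1 + 1 by ring]
  exact hq _

theorem QGeneric.qPoch_ne_zero (hq : QGeneric q) (n : ℕ) : qPoch q q n ≠ 0 :=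
  Finset.prod_ne_zero_iff.2 fun j _ => by rw [← pow_succ']; exact hq j

theorem QGeneric.qPoch_odd_ne_zero (hq : QGeneric q) (n : ℕ) : qPoch q (q ^ 2) n ≠ 0 :=
  Finset.prod_ne_zero_iff.2 fun j _ => by rw [← pow_mul, ← pow_succ']; exact hq _

theorem invPoch_natCast (q : K) (n : ℕ) : invPoch q (n : ℤ) = (qPoch q q n)⁻¹ := by
  simp [invPoch]

theorem invPoch_of_neg (q : K) {n : ℤ} (h : n < 0) : invPoch q n = 0 := by
  simp [invPoch, h]

theorem invPoch_zero (q : K) : invPoch q 0 = 1 := by simp [invPoch, qPoch_zero]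

theorem qPoch_mul_invPoch (hq : QGeneric q) (n : ℕ) : qPoch q q n * invPoch q n = 1 := by
  rw [invPoch_natCast, mul_inv_cancel₀ (hq.qPoch_ne_zero n)]

theorem invPoch_succ (hq : QGeneric q) (n : ℕ) :
    (1 - q ^ (n + 1)) * invPoch q ((n : ℤ) + 1) = invPoch q n := by
  have h := hq n
  have h' := hq.qPoch_ne_zero n
  rw [← Nat.cast_succ, invPoch_natCast, invPoch_natCast, Nat.succ_eq_add_one, qPoch_self_succ]
  field_simp

theorem invPoch_sub_one (hq : QGeneric q) (n : ℕ) :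
    (1 - q ^ n) * invPoch q n = invPoch q ((n : ℤ) - 1) := by
  cases n with
  | zero => simp [invPoch_of_neg]
  | succ n => rw [Nat.cast_succ, invPoch_succ hq, add_sub_cancel_right]

/-- Valid for all integers: the zero extension of `invPoch` encodes the support of the `q`-binomial.
For `a < 0` the value of `a.toNat` is irrelevant, since `b` or `a - b` is negative. -/
theorem qBinom_eq_invPoch (hq : QGeneric q) (a b : ℤ) :
    qBinom q a b = qPoch q q a.toNat * invPoch q b * invPoch q (a - b) := by
  by_cases h : 0 ≤ b ∧ 0 ≤ a - b
  · obtain ⟨n, rfl⟩ := Int.eq_ofNat_of_zero_le h.1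
    obtain ⟨m, hm⟩ := Int.eq_ofNat_of_zero_le h.2
    obtain rfl : a = n + m := by omega
    have hn := hq.qPoch_ne_zero n
    have hm' := hq.qPoch_ne_zero m
    rw [qBinom_eq_div q n m (mul_ne_zero hn hm'), hm, invPoch_natCast, invPoch_natCast,
      ← Nat.cast_add, Int.toNat_natCast]
    field_simp
  · rw [qBinom, if_neg h]
    rcases not_and_or.1 h with h | h
    · rw [invPoch_of_neg q (by omega : b < 0)]; ring
    · rw [invPoch_of_neg q (by omega : a - b < 0)]; ring

/-! ### Terminating summation formulas. -/

/-- The finite `q`-binomial theorem. -/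
theorem sum_antidiagonal_qBinomial (hq : QGeneric q) (x : K) (n : ℕ) :
    ∑ p ∈ Finset.HasAntidiagonal.antidiagonal n, (-x) ^ p.1 * q ^ triangular p.1 * invPoch q p.1 * invPoch q p.2 =
      qPoch (x * q) q n * invPoch q n := by
  induction n with
  | zero => simp [qPoch_zero, invPoch_zero, triangular_zero]
  | succ n ih =>
    apply mul_left_cancel₀ (hq n)
    -- On `a + b = n + 1`, `1 - q^(a+b) = q^b (1 - q^a) + (1 - q^b)`. Each part cancels the top
    -- factor of one reciprocal and becomes a multiple of the sum for `n`.
    have key : ∀ p ∈ Finset.HasAntidiagonal.antidiagonal (n + 1), (1 - q ^ (n + 1)) *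
        ((-x) ^ p.1 * q ^ triangular p.1 * invPoch q p.1 * invPoch q p.2) =
        q ^ p.2 * (1 - q ^ p.1) *
          ((-x) ^ p.1 * q ^ triangular p.1 * invPoch q p.1 * invPoch q p.2) +
        (1 - q ^ p.2) *
          ((-x) ^ p.1 * q ^ triangular p.1 * invPoch q p.1 * invPoch q p.2) := by
      intro p hp
      rw [← Finset.HasAntidiagonal.mem_antidiagonal.1 hp, pow_add]
      ring
    rw [Finset.mul_sum, Finset.sum_congr rfl key, Finset.sum_add_distrib,
      Finset.Nat.sum_antidiagonal_succ, Finset.Nat.sum_antidiagonal_succ']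
    simp only [pow_zero, sub_self, mul_zero, zero_mul, zero_add, Nat.cast_add, Nat.cast_one]
    have h1 : ∀ p ∈ Finset.HasAntidiagonal.antidiagonal n, q ^ p.2 * (1 - q ^ (p.1 + 1)) *
        ((-x) ^ (p.1 + 1) * q ^ triangular ((p.1 : ℤ) + 1) * invPoch q ((p.1 : ℤ) + 1) *
          invPoch q p.2) = (-x * q ^ (n + 1)) *
        ((-x) ^ p.1 * q ^ triangular p.1 * invPoch q p.1 * invPoch q p.2) := by
      intro p hp
      rw [← invPoch_succ hq p.1, ← Finset.HasAntidiagonal.mem_antidiagonal.1 hp, triangular_succ]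
      ring
    have h2 : ∀ p ∈ Finset.HasAntidiagonal.antidiagonal n, (1 - q ^ (p.2 + 1)) *
        ((-x) ^ p.1 * q ^ triangular p.1 * invPoch q p.1 * invPoch q ((p.2 : ℤ) + 1)) =
        (-x) ^ p.1 * q ^ triangular p.1 * invPoch q p.1 * invPoch q p.2 := by
      intro p _
      rw [← invPoch_succ hq p.2]
      ring
    rw [Finset.sum_congr rfl h1, Finset.sum_congr rfl h2, ← Finset.mul_sum, ih, qPoch_succ,
      ← invPoch_succ hq n]
    ring

/-- This is the coefficient of `x^n` in `(xq; q²)_∞ / (x; q)_∞ = 1 / (x; q²)_∞`. The proof compares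
the recurrences in `n`. -/
theorem sum_antidiagonal_neg_one_pow_mul_sq (hq : QGeneric q) (n : ℕ) :
    ∑ p ∈ Finset.HasAntidiagonal.antidiagonal n,
      (-1) ^ p.1 * q ^ (p.1 ^ 2) * invPoch (q ^ 2) p.1 * invPoch q p.2 = invPoch (q ^ 2) n := by
  induction n with
  | zero => simp [invPoch_zero]
  | succ n ih =>
    apply mul_left_cancel₀ (hq.sq n)
    have key : ∀ p ∈ Finset.HasAntidiagonal.antidiagonal (n + 1), (1 - (q ^ 2) ^ (n + 1)) *
        ((-1) ^ p.1 * q ^ (p.1 ^ 2) * invPoch (q ^ 2) p.1 * invPoch q p.2) =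
        q ^ p.2 * (1 - (q ^ 2) ^ p.1) *
          ((-1) ^ p.1 * q ^ (p.1 ^ 2) * invPoch (q ^ 2) p.1 * invPoch q p.2) +
        (1 + (q ^ 2) ^ p.1 * q ^ p.2) * (1 - q ^ p.2) *
          ((-1) ^ p.1 * q ^ (p.1 ^ 2) * invPoch (q ^ 2) p.1 * invPoch q p.2) := by
      intro p hp
      rw [← Finset.HasAntidiagonal.mem_antidiagonal.1 hp]
      ring
    rw [Finset.mul_sum, Finset.sum_congr rfl key, Finset.sum_add_distrib,
      Finset.Nat.sum_antidiagonal_succ, Finset.Nat.sum_antidiagonal_succ']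
    simp only [pow_zero, sub_self, mul_zero, zero_mul, zero_add, Nat.cast_add, Nat.cast_one]
    -- After the index shifts the two contributions carry the weights `-q^(2a+b+1)` and `1 +
    -- q^(2a+b+1)`, which add up to `1` term by term.
    rw [← Finset.sum_add_distrib, invPoch_succ hq.sq, ← ih]
    refine Finset.sum_congr rfl fun p _ => ?_
    rw [← invPoch_succ hq p.2, ← invPoch_succ hq.sq p.1]
    ring

/-- The two-variable form of the `q`-Chu–Vandermonde summation. -/
theorem sum_antidiagonal_vandermonde (hq : QGeneric q) (M i j : ℕ) :
    ∑ p ∈ Finset.HasAntidiagonal.antidiagonal i, q ^ (p.2 * (j - p.1)) * invPoch q p.1 * invPoch q p.2 *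
      invPoch q ((j : ℤ) - p.1) * invPoch q ((M : ℤ) - j - p.2) =
    qPoch q q M * invPoch q i * invPoch q j * invPoch q ((M : ℤ) - i) *
      invPoch q ((M : ℤ) - j) := by
  induction i generalizing M j with
  | zero =>
    simp only [Finset.Nat.antidiagonal_zero, Finset.sum_singleton, Nat.cast_zero, sub_zero, zero_mul,
      pow_zero, invPoch_zero]
    linear_combination (-(invPoch q j * invPoch q ((M : ℤ) - j))) * qPoch_mul_invPoch hq M
  | succ i ih =>
    cases j with
    | zero =>
      rw [Finset.Nat.sum_antidiagonal_succ, Finset.sum_eq_zero]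
      · simp only [Nat.cast_zero, sub_zero, Nat.zero_sub, mul_zero, pow_zero, invPoch_zero]
        linear_combination (-(invPoch q (i + 1 : ℕ) * invPoch q ((M : ℤ) - (i + 1 : ℕ)))) *
          qPoch_mul_invPoch hq M
      · intro p _
        rw [invPoch_of_neg q (n := ((0 : ℕ) : ℤ) - _) (by omega)]
        ring
    | succ j =>
      cases M with
      | zero =>
        rw [invPoch_of_neg q (n := ((0 : ℕ) : ℤ) - ((i + 1 : ℕ) : ℤ)) (by omega),
          Finset.sum_eq_zero]
        · ring
        · intro p _
          rw [invPoch_of_neg q (n := ((0 : ℕ) : ℤ) - _ - _) (by omega)]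
          ring
      | succ M =>
        apply mul_left_cancel₀ (hq i)
        -- This splitting gives a `q`-Pascal recursion: the two parts are the sums for `(M, i, j)`
        -- and `q^(j+1)` times `(M, i, j+1)`.
        have key : ∀ p ∈ Finset.HasAntidiagonal.antidiagonal (i + 1), ∀ c : K,
            (1 - q ^ (i + 1)) * c = (1 - q ^ p.1) * c + q ^ p.1 * (1 - q ^ p.2) * c := by
          intro p hp c
          rw [← Finset.HasAntidiagonal.mem_antidiagonal.1 hp]
          ring
        rw [Finset.mul_sum, Finset.sum_congr rfl fun p hp => key p hp _, Finset.sum_add_distrib,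
          Finset.Nat.sum_antidiagonal_succ, Finset.Nat.sum_antidiagonal_succ']
        simp only [pow_zero, sub_self, mul_zero, zero_mul, zero_add, Nat.cast_add, Nat.cast_one]
        have h1 : ∀ p ∈ Finset.HasAntidiagonal.antidiagonal i,
            (1 - q ^ (p.1 + 1)) * (q ^ (p.2 * (j + 1 - (p.1 + 1))) * invPoch q ((p.1 : ℤ) + 1) *
              invPoch q p.2 * invPoch q ((j : ℤ) + 1 - (p.1 + 1)) *
                invPoch q ((M : ℤ) + 1 - (j + 1) - p.2)) =
            q ^ (p.2 * (j - p.1)) * invPoch q p.1 * invPoch q p.2 *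
              invPoch q ((j : ℤ) - p.1) * invPoch q ((M : ℤ) - j - p.2) := by
          intro p _
          rw [← invPoch_succ hq p.1, Nat.add_sub_add_right, add_sub_add_right_eq_sub,
            add_sub_add_right_eq_sub]
          ring
        have h2 : ∀ p ∈ Finset.HasAntidiagonal.antidiagonal i,
            q ^ p.1 * (1 - q ^ (p.2 + 1)) * (q ^ ((p.2 + 1) * (j + 1 - p.1)) * invPoch q p.1 *
              invPoch q ((p.2 : ℤ) + 1) * invPoch q ((j : ℤ) + 1 - p.1) *
                invPoch q ((M : ℤ) + 1 - (j + 1) - (p.2 + 1))) =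
            q ^ (j + 1) * (q ^ (p.2 * (j + 1 - p.1)) * invPoch q p.1 * invPoch q p.2 *
              invPoch q (((j + 1 : ℕ) : ℤ) - p.1) *
                invPoch q ((M : ℤ) - ((j + 1 : ℕ) : ℤ) - p.2)) := by
          intro p _
          push_cast
          -- The truncated exponent `j + 1 - p.1` is the true one here; otherwise a reciprocal
          -- vanishes.
          by_cases hp : p.1 ≤ j + 1
          · rw [← invPoch_succ hq p.2, show (M : ℤ) + 1 - (j + 1) - (p.2 + 1) =
              M - (j + 1) - p.2 by ring]
            have e : q ^ (j + 1) = q ^ p.1 * q ^ (j + 1 - p.1) := by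
              rw [← pow_add, Nat.add_sub_of_le hp]
            rw [e]
            ring
          · rw [invPoch_of_neg q (n := (j : ℤ) + 1 - p.1) (by omega)]
            ring
        rw [Finset.sum_congr rfl h1, Finset.sum_congr rfl h2, ← Finset.mul_sum, ih, ih,
          add_sub_add_right_eq_sub, add_sub_add_right_eq_sub]
        by_cases hj : j ≤ M
        -- With `M = j + d`, the two values combine by `(1 - q^(j+1)) + q^(j+1) (1 - q^d) = 1 -
        -- q^(M+1)`.
        · obtain ⟨d, rfl⟩ := Nat.exists_eq_add_of_le hj
          have e1 := invPoch_sub_one hq d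
          have e2 := invPoch_succ hq i
          have e3 := invPoch_succ hq j
          rw [show ((j + d : ℕ) : ℤ) - ((j + 1 : ℕ) : ℤ) = d - 1 by push_cast; ring,
            show ((j + d : ℕ) : ℤ) - (j : ℤ) = d by push_cast; ring, ← e1, ← e2, ← e3,
            qPoch_self_succ, Nat.cast_succ]
          ring
        · rw [invPoch_of_neg q (n := (M : ℤ) - j) (by omega),
            invPoch_of_neg q (n := (M : ℤ) - ((j + 1 : ℕ) : ℤ)) (by omega)]
          ring

/-- A terminating well-poised summation. -/
theorem sum_antidiagonal_wellPoised (hq : QGeneric q) (d w : ℕ) :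
    ∑ p ∈ Finset.HasAntidiagonal.antidiagonal w, (-1) ^ p.2 * qPoch q q (p.2 + d) *
      qPoch q q (p.1 + d) * invPoch q p.1 * invPoch q p.2 =
    if Even w then qPoch (q ^ 2) (q ^ 2) (w / 2 + d) * invPoch (q ^ 2) (w / 2 : ℕ) *
      qPoch q q d ^ 2 * invPoch (q ^ 2) d else 0 := by
  induction d generalizing w with
  | zero =>
    -- For `d = 0` all factorials cancel, leaving an alternating sum of signs.
    have key : ∀ p ∈ Finset.HasAntidiagonal.antidiagonal w, (-1 : K) ^ p.2 *
        qPoch q q (p.2 + 0) * qPoch q q (p.1 + 0) * invPoch q p.1 * invPoch q p.2 =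
          (-1) ^ p.2 := by
      intro p _
      rw [add_zero, add_zero]
      linear_combination (-1 : K) ^ p.2 * (qPoch q q p.1 * invPoch q p.1 *
        qPoch_mul_invPoch hq p.2 + qPoch_mul_invPoch hq p.1)
    rw [Finset.sum_congr rfl key, ← Finset.Nat.sum_antidiagonal_swap]
    simp only [Prod.snd_swap]
    rw [Finset.Nat.sum_antidiagonal_eq_sum_range_succ_mk]
    simp only [neg_one_geom_sum, Nat.even_add_one]
    have h := qPoch_mul_invPoch hq.sq (w / 2)
    by_cases hw : Even w
    · simp only [hw, not_true, if_false, if_true, add_zero, qPoch_zero,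
        Nat.cast_zero, invPoch_zero, h, one_pow, mul_one]
    · simp only [hw, not_false_iff, if_true, if_false]
  | succ d ihd =>
    induction w using Nat.twoStepInduction with
    | zero =>
      have h := qPoch_mul_invPoch hq.sq (d + 1)
      simp only [Finset.Nat.antidiagonal_zero, Finset.sum_singleton, Nat.cast_zero, invPoch_zero,
        pow_zero, zero_add, Nat.zero_div, Even.zero, if_true]
      linear_combination (-qPoch q q (d + 1) ^ 2) * h
    | one =>
      simp [Finset.Nat.sum_antidiagonal_succ]
      ring
    | more w ih _ =>
      -- With `Q = q^(d+1)`, the identity used is `(1 - Q q^a)(1 - Q q^b) = (1 - Q q^(a+b))(1 - Q) +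
      -- Q (1 - q^a)(1 - q^b)`. The last product lowers both indices, so the sum at `(d+1, w+2)` is
      -- expressed through those at `(d, w+2)` and `(d+1, w)`.
      have key : ∀ p ∈ Finset.HasAntidiagonal.antidiagonal (w + 2), (-1) ^ p.2 *
          qPoch q q (p.2 + (d + 1)) * qPoch q q (p.1 + (d + 1)) * invPoch q p.1 *
            invPoch q p.2 =
          (1 - q ^ (w + d + 3)) * (1 - q ^ (d + 1)) * ((-1) ^ p.2 *
            qPoch q q (p.2 + d) * qPoch q q (p.1 + d) * invPoch q p.1 * invPoch q p.2) +
          q ^ (d + 1) * ((1 - q ^ p.1) * (1 - q ^ p.2) * ((-1) ^ p.2 *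
            qPoch q q (p.2 + d) * qPoch q q (p.1 + d) * invPoch q p.1 * invPoch q p.2)) := by
        intro p hp
        rw [show w + d + 3 = (w + 2) + (d + 1) by ring,
          ← Finset.HasAntidiagonal.mem_antidiagonal.1 hp, ← add_assoc, ← add_assoc,
          qPoch_self_succ, qPoch_self_succ]
        ring
      rw [Finset.sum_congr rfl key, Finset.sum_add_distrib, ← Finset.mul_sum, ← Finset.mul_sum,
        ihd, Finset.Nat.sum_antidiagonal_succ, Finset.Nat.sum_antidiagonal_succ']
      simp only [pow_zero, sub_self, mul_zero, zero_mul, zero_add, Nat.cast_add, Nat.cast_one]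
      have h1 : ∀ p ∈ Finset.HasAntidiagonal.antidiagonal w,
          (1 - q ^ (p.1 + 1)) * (1 - q ^ (p.2 + 1)) * ((-1) ^ (p.2 + 1) *
            qPoch q q (p.2 + 1 + d) * qPoch q q (p.1 + 1 + d) * invPoch q ((p.1 : ℤ) + 1) *
              invPoch q ((p.2 : ℤ) + 1)) =
          -((-1) ^ p.2 * qPoch q q (p.2 + (d + 1)) * qPoch q q (p.1 + (d + 1)) *
            invPoch q p.1 * invPoch q p.2) := by
        intro p _
        rw [← invPoch_succ hq p.1, ← invPoch_succ hq p.2, add_assoc, add_comm 1 d, add_assoc,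
          add_comm 1 d]
        ring
      rw [Finset.sum_congr rfl h1, Finset.sum_neg_distrib, ih]
      by_cases hw : Even w
      · obtain ⟨n, rfl⟩ := hw
        have h1 : Even (n + n) := ⟨n, rfl⟩
        have h2 : Even (n + n + 2) := ⟨n + 1, by ring⟩
        simp only [h1, h2, if_true]
        rw [show (n + n + 2) / 2 = n + 1 by omega, show (n + n) / 2 = n by omega,
          show n + 1 + (d + 1) = n + d + 1 + 1 by ring, show n + (d + 1) = n + d + 1 by ring,
          show n + 1 + d = n + d + 1 by ring, qPoch_self_succ (q ^ 2) (n + d + 1),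
          qPoch_self_succ q d, ← invPoch_succ hq.sq d, ← invPoch_succ hq.sq n, Nat.cast_succ,
          Nat.cast_succ]
        ring
      · have h2 : ¬Even (w + 2) := by rw [Nat.even_add]; simpa using hw
        simp only [hw, h2, if_false]
        ring

/-- A terminating `q`-Gauss summation in base `q^2`. -/
theorem sum_range_qGauss (hq : QGeneric q) (m N B : ℕ) (hB : N < 2 * B) :
    ∑ l ∈ Finset.range B, invPoch (q ^ 2) l * q ^ triangular ((N : ℤ) - 2 * l - 1) *
      (qPoch q (q ^ 2) (m + l + 1))⁻¹ * invPoch q ((N : ℤ) - 2 * l) =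
    qPoch (q ^ 2) (q ^ 2) (N + m) * invPoch q (N + 2 * m + 1 : ℕ) * invPoch q N := by
  have hO : ∀ l : ℕ, (1 - q ^ (2 * m + 1 + 2 * l)) * (qPoch q (q ^ 2) (m + l + 1))⁻¹ =
      (qPoch q (q ^ 2) (m + l))⁻¹ := by
    intro l
    have h := hq (2 * m + 2 * l)
    have h' := hq.qPoch_odd_ne_zero (m + l)
    rw [qPoch_succ, ← pow_mul, ← pow_succ', show 2 * m + 1 + 2 * l = 2 * m + 2 * l + 1 by ring,
      show 2 * (m + l) + 1 = 2 * m + 2 * l + 1 by ring]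
    field_simp
  induction N with
  | zero =>
    rw [Finset.sum_eq_single_of_mem 0 (Finset.mem_range.2 (by omega))]
    · have h1 := qPoch_mul_invPoch hq.sq m
      have h2 := hq.qPoch_odd_ne_zero (m + 1)
      have h3 := hq.sq.qPoch_ne_zero m
      simp only [Nat.cast_zero, mul_zero, sub_zero, invPoch_zero, zero_sub, triangular_neg_one,
        pow_zero, add_zero, zero_add, one_mul, mul_one]
      rw [invPoch_natCast, qPoch_two_mul_add_one]
      field_simp
    · intro l _ hl
      rw [invPoch_of_neg q (by omega)]
      ring
  | succ N ih =>
    -- A telescoping certificate: `key` is a first-order recurrence in `N` up to the difference `G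
    -- (l + 1) - G l`. `G` vanishes at `0` because of `1 - (q²)^0`, and at `B` because `N + 1 < 2B`.
    set G : ℕ → K := fun l => -((1 - (q ^ 2) ^ l) * invPoch (q ^ 2) l *
      (1 - q ^ (2 * m + 1 + 2 * l)) * (qPoch q (q ^ 2) (m + l + 1))⁻¹ *
        q ^ triangular ((N : ℤ) + 1 - 2 * l) * invPoch q ((N : ℤ) + 1 - 2 * l)) with hG
    have key : ∀ l ∈ Finset.range B,
        (1 - q ^ (N + 1)) * (1 - q ^ (N + 2 * m + 2)) *
          (invPoch (q ^ 2) l * q ^ triangular (((N + 1 : ℕ) : ℤ) - 2 * l - 1) *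
            (qPoch q (q ^ 2) (m + l + 1))⁻¹ * invPoch q (((N + 1 : ℕ) : ℤ) - 2 * l)) =
        (1 - q ^ (2 * N + 2 * m + 2)) *
          (invPoch (q ^ 2) l * q ^ triangular ((N : ℤ) - 2 * l - 1) *
            (qPoch q (q ^ 2) (m + l + 1))⁻¹ * invPoch q ((N : ℤ) - 2 * l)) +
        (G (l + 1) - G l) := by
      intro l _
      have hG1 : G (l + 1) = -(invPoch (q ^ 2) l * (qPoch q (q ^ 2) (m + l + 1))⁻¹ *
          q ^ triangular ((N : ℤ) - 2 * l - 1) * invPoch q ((N : ℤ) - 2 * l - 1)) := by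
        simp only [hG]
        have h := hO (l + 1)
        rw [← add_assoc] at h
        rw [mul_assoc _ (1 - q ^ (2 * m + 1 + 2 * (l + 1))), ← add_assoc, h, Nat.cast_succ,
          invPoch_succ hq.sq, show (N : ℤ) + 1 - 2 * ((l : ℤ) + 1) = N - 2 * l - 1 by ring]
      rw [hG1]
      simp only [hG, Nat.cast_succ]
      rcases le_or_gt (2 * l) N with h | h
      · obtain ⟨M, rfl⟩ := Nat.exists_eq_add_of_le h
        have e1 := invPoch_sub_one hq M
        have e2 := invPoch_succ hq M
        rw [show ((2 * l + M : ℕ) : ℤ) + 1 - 2 * l - 1 = M by push_cast; ring,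
          show ((2 * l + M : ℕ) : ℤ) + 1 - 2 * l = M + 1 by push_cast; ring,
          show ((2 * l + M : ℕ) : ℤ) - 2 * l = M by push_cast; ring, ← e1, ← e2,
          triangular_succ, triangular_sub_one]
        ring
      · rw [invPoch_of_neg q (n := (N : ℤ) - 2 * l) (by omega),
          invPoch_of_neg q (n := (N : ℤ) - 2 * l - 1) (by omega)]
        -- At `2l = N + 1` only the term for `N + 1` and `G l` are nonzero; there `T_{-1} = T_0 =
        -- 0`.
        rcases eq_or_ne (2 * l) (N + 1) with h | h
        · rw [show (N : ℤ) + 1 - 2 * l - 1 = -1 by omega, show (N : ℤ) + 1 - 2 * l = 0 by omega,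
            triangular_neg_one, triangular_zero,
            show N + 2 * m + 2 = 2 * m + 1 + 2 * l by omega, ← h]
          ring
        · rw [invPoch_of_neg q (n := (N : ℤ) + 1 - 2 * l) (by omega)]
          ring
    apply mul_left_cancel₀ (mul_ne_zero (hq N) (hq (N + 2 * m + 1)))
    have hGB : G B = 0 := by
      simp only [hG]
      rw [invPoch_of_neg q (n := (N : ℤ) + 1 - 2 * B) (by omega)]
      ring
    have hG0 : G 0 = 0 := by simp [hG]
    rw [Finset.mul_sum, Finset.sum_congr rfl key, Finset.sum_add_distrib, ← Finset.mul_sum,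
      ih (by omega), Finset.sum_range_sub, hGB, hG0, show N + 1 + m = N + m + 1 by ring,
      qPoch_self_succ (q ^ 2) (N + m), show N + 1 + 2 * m + 1 = N + 2 * m + 1 + 1 by ring,
      Nat.cast_succ (N + 2 * m + 1), Nat.cast_succ N, ← invPoch_succ hq N,
      ← invPoch_succ hq (N + 2 * m + 1)]
    ring

end Field

/-! ### Reindexing of finitely supported sums. -/

section RangeSums

variable {M : Type*} [AddCommMonoid M]

theorem sum_range_extend {f : ℕ → M} {n m : ℕ} (hnm : n ≤ m) (hf : ∀ i, n ≤ i → f i = 0) :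
    ∑ i ∈ Finset.range m, f i = ∑ i ∈ Finset.range n, f i := by
  refine (Finset.sum_subset (Finset.range_subset_range.2 hnm) fun i _ hi => hf i ?_).symm
  simpa using hi

theorem sum_range_shift {f : ℕ → M} (n t : ℕ) (h1 : ∀ i, i < t → f i = 0)
    (h2 : ∀ i, n ≤ i → f i = 0) :
    ∑ i ∈ Finset.range n, f i = ∑ r ∈ Finset.range n, f (r + t) := by
  rw [← sum_range_extend (Nat.le_add_left n t) h2, Finset.sum_range_add,
    Finset.sum_eq_zero fun i hi => h1 i (Finset.mem_range.1 hi), zero_add]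
  exact Finset.sum_congr rfl fun r _ => by rw [add_comm]

theorem sum_range_even {f : ℕ → M} (n : ℕ) (hf : ∀ i, n ≤ 2 * i → f i = 0) :
    ∑ w ∈ Finset.range n, (if Even w then f (w / 2) else 0) = ∑ i ∈ Finset.range n, f i := by
  rw [← sum_range_extend (by omega : n ≤ 2 * n)]
  · have h : ∀ k, ∑ w ∈ Finset.range (2 * k), (if Even w then f (w / 2) else 0) =
        ∑ i ∈ Finset.range k, f i := by
      intro k
      induction k with
      | zero => rfl
      | succ k ih =>
        rw [show 2 * (k + 1) = 2 * k + 1 + 1 by ring, Finset.sum_range_succ,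
          Finset.sum_range_succ, ih, Finset.sum_range_succ, if_pos (even_two_mul k),
          if_neg (by simp), add_zero, Nat.mul_div_cancel_left k two_pos]
    exact h n
  · intro w hw
    split_ifs with h
    · exact hf _ (by rw [Nat.two_mul_div_two_of_even h]; exact hw)
    · rfl

theorem sum_range_sum_range {f : ℕ → ℕ → M} (n : ℕ) (hf : ∀ r u, n ≤ r + u → f r u = 0) :
    ∑ r ∈ Finset.range n, ∑ u ∈ Finset.range n, f r u =
      ∑ w ∈ Finset.range n, ∑ p ∈ Finset.HasAntidiagonal.antidiagonal w, f p.1 p.2 := by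
  rw [← Finset.sum_product', Finset.sum_sigma']
  refine (Finset.sum_bij_ne_zero (fun p _ _ => p.2) ?_ ?_ ?_ ?_).symm
  · rintro ⟨w, r, u⟩ h _
    simp only [Finset.mem_sigma, Finset.mem_range, Finset.HasAntidiagonal.mem_antidiagonal,
      Finset.mem_product] at h ⊢
    omega
  · rintro ⟨w, p⟩ h _ ⟨w', p'⟩ h' _ e
    simp only [Finset.mem_sigma, Finset.HasAntidiagonal.mem_antidiagonal] at h h' e
    obtain rfl := e
    obtain rfl : w = w' := h.2.symm.trans h'.2
    rfl
  · rintro ⟨r, u⟩ _ h0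
    refine ⟨⟨r + u, r, u⟩, ?_, h0, rfl⟩
    simp only [Finset.mem_sigma, Finset.mem_range, Finset.HasAntidiagonal.mem_antidiagonal,
      and_true]
    by_contra h
    exact h0 (hf _ _ (by omega))
  · intros; rfl

/-- Serves the substitution `i = r + t`, `j = u + t`. The support conditions allow the same bound
`n` to be kept throughout. -/
theorem sum_range_sum_range_shift {f : ℕ → ℕ → M} (n t : ℕ) (h1 : ∀ i j, i < t → f i j = 0)
    (h2 : ∀ i j, j < t → f i j = 0) (h3 : ∀ i j, n ≤ i + j → f i j = 0) :
    ∑ i ∈ Finset.range n, ∑ j ∈ Finset.range n, f i j =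
      ∑ w ∈ Finset.range n, ∑ p ∈ Finset.HasAntidiagonal.antidiagonal w,
        f (p.1 + t) (p.2 + t) := by
  rw [← sum_range_sum_range (f := fun r u => f (r + t) (u + t)) n
    fun r u h => h3 _ _ (by omega)]
  rw [sum_range_shift n t]
  · exact Finset.sum_congr rfl fun r _ =>
      sum_range_shift n t (fun j hj => h2 _ j hj) fun j hj => h3 _ j (by omega)
  · exact fun i hi => Finset.sum_eq_zero fun j _ => h1 i j hi
  · exact fun i hi => Finset.sum_eq_zero fun j _ => h3 i j (by omega)

end RangeSums

/-! ### Evaluation of both sides for generic `q`. -/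

section Field

variable {K : Type*} [Field K] {q : K}

/-- The coefficientwise form common to both sides of the identity. -/
noncomputable def commonTerm (q z : K) (L m : ℕ) : K :=
  (-(z ^ 2)) ^ m * q ^ (m ^ 2 + m) * invPoch (q ^ 2) m * qPoch (q ^ 2) (q ^ 2) (L - m) *
    invPoch q ((L : ℤ) - 2 * m)

/-- The single sum over a field with generic `q`. -/
theorem sum_singleTerm (hq : QGeneric q) (z : K) (L : ℕ) :
    ∑ j ∈ Finset.range (L + 1), singleTerm q z L j =
      ∑ m ∈ Finset.range (L + 1), commonTerm q z L m := by
  let f : ℕ → ℕ → K := fun m l => (-(z ^ 2)) ^ m * q ^ (m ^ 2 + m) * invPoch (q ^ 2) m *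
    qPoch q q (L + 1) * (invPoch (q ^ 2) l * q ^ triangular ((L : ℤ) - 2 * m - 2 * l - 1) *
      (qPoch q (q ^ 2) (m + l + 1))⁻¹ * invPoch q ((L : ℤ) - 2 * m - 2 * l))
  have h1 : ∀ j ∈ Finset.range (L + 1), singleTerm q z L j =
      ∑ p ∈ Finset.HasAntidiagonal.antidiagonal j, f p.1 p.2 := by
    intro j _
    have hb := sum_antidiagonal_qBinomial hq.sq (z ^ 2) j
    have h2 := hq.sq.qPoch_ne_zero j
    have h3 := hq.qPoch_odd_ne_zero (j + 1)
    -- Splitting `(q; q)_{2j+1}` into odd and even factors supplies the `1 / (q²; q²)_j` needed for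
    -- the base-`q²` binomial theorem.
    have h4 : qPoch (z ^ 2 * q ^ 2) (q ^ 2) j * invPoch q ((2 * j + 1 : ℕ) : ℤ) =
        qPoch (z ^ 2 * q ^ 2) (q ^ 2) j * invPoch (q ^ 2) j *
          (qPoch q (q ^ 2) (j + 1))⁻¹ := by
      rw [invPoch_natCast, invPoch_natCast, qPoch_two_mul_add_one]
      field_simp
    have h5 : singleTerm q z L j = qPoch (z ^ 2 * q ^ 2) (q ^ 2) j *
        invPoch q ((2 * j + 1 : ℕ) : ℤ) * (q ^ triangular ((L : ℤ) - 2 * j - 1) *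
          qPoch q q (L + 1) * invPoch q ((L : ℤ) - 2 * j)) := by
      rw [singleTerm, qBinom_eq_invPoch hq, show ((L : ℤ) + 1).toNat = L + 1 by omega,
        show (L : ℤ) + 1 - (2 * j + 1) = L - 2 * j by ring]
      push_cast
      ring
    rw [h5, h4, ← hb, Finset.sum_mul, Finset.sum_mul]
    refine Finset.sum_congr rfl fun p hp => ?_
    obtain rfl := Finset.HasAntidiagonal.mem_antidiagonal.1 hp
    simp only [f]
    rw [show (L : ℤ) - 2 * ((p.1 + p.2 : ℕ) : ℤ) = L - 2 * p.1 - 2 * p.2 by push_cast; ring,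
      ← pow_mul, two_mul_triangular, show p.1 * (p.1 + 1) = p.1 ^ 2 + p.1 by ring]
    ring
  rw [Finset.sum_congr rfl h1, ← sum_range_sum_range]
  · refine Finset.sum_congr rfl fun m _ => ?_
    simp only [f, ← Finset.mul_sum]
    rcases le_or_gt (2 * m) L with h | h
    · obtain ⟨N, rfl⟩ := Nat.exists_eq_add_of_le h
      have e := qPoch_mul_invPoch hq (2 * m + N + 1)
      rw [commonTerm, show ((2 * m + N : ℕ) : ℤ) - 2 * m = N by push_cast; ring,
        sum_range_qGauss hq m N _ (by omega), show 2 * m + N - m = N + m by omega,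
        show N + 2 * m + 1 = 2 * m + N + 1 by ring]
      linear_combination ((-(z ^ 2)) ^ m * q ^ (m ^ 2 + m) * invPoch (q ^ 2) m *
        qPoch (q ^ 2) (q ^ 2) (N + m) * invPoch q N) * e
    · rw [commonTerm, invPoch_of_neg q (by omega), Finset.sum_eq_zero]
      · ring
      · intro l _
        rw [invPoch_of_neg q (by omega)]
        ring
  · intro m l h
    simp only [f]
    rw [invPoch_of_neg q (by omega)]
    ring

/-- The `q`-binomial theorem at `x = -1`; the bound `P ≤ L` ensures that the range contains the
whole support. -/
theorem sum_range_triangular_mul_invPoch (hq : QGeneric q) (L : ℕ) (P : ℤ) (hP : P ≤ L) :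
    ∑ k ∈ Finset.range (L + 1), q ^ triangular k * invPoch q k * invPoch q (P - k) =
      qPoch (-q) q P.toNat * invPoch q P := by
  rcases lt_or_ge P 0 with h | h
  · rw [invPoch_of_neg q h, Finset.sum_eq_zero, mul_zero]
    intro k _
    rw [invPoch_of_neg q (n := P - k) (by omega), mul_zero]
  · obtain ⟨n, rfl⟩ := Int.eq_ofNat_of_zero_le h
    have hb := sum_antidiagonal_qBinomial hq (-1) n
    rw [Finset.Nat.sum_antidiagonal_eq_sum_range_succ_mk] at hb
    rw [sum_range_extend (by omega : n + 1 ≤ L + 1), Int.toNat_natCast,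
      show -q = -1 * q by ring, ← hb]
    · refine Finset.sum_congr rfl fun k hk => ?_
      rw [Finset.mem_range] at hk
      rw [Nat.cast_sub (by omega), neg_neg, one_pow, one_mul]
    · intro k hk
      rw [invPoch_of_neg q (n := (n : ℤ) - k) (by omega), mul_zero]

/-- The triple sum over a field with generic `q`. -/
theorem sum_tripleTerm (hq : QGeneric q) (z : K) (L : ℕ) :
    ∑ i ∈ Finset.range (L + 1), ∑ j ∈ Finset.range (L + 1), ∑ k ∈ Finset.range (L + 1),
      tripleTerm q z L i j k = ∑ m ∈ Finset.range (L + 1), commonTerm q z L m := by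
  -- `c` collects the factors free of `k`, `f` is the summand after Vandermonde and summation over
  -- `k`, and `h` is the result of the well-poised sum over `i` and `j` at fixed `t` and `w = 2n`.
  let c : ℕ → ℕ → K := fun i j => (-1) ^ j * z ^ (i + j) * q ^ (triangular i + triangular j) *
    qPoch q q (L - i) * qPoch q q (L - j) * invPoch q ((L : ℤ) - i - j)
  let f : ℕ → ℕ → ℕ → K := fun t i j => c i j * (q ^ ((i - t) * (j - t)) * invPoch q t *
    invPoch q ((i : ℤ) - t) * invPoch q ((j : ℤ) - t) *
      (qPoch (-q) q ((L : ℤ) - j - (i - t)).toNat * invPoch q ((L : ℤ) - j - (i - t))))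
  let h : ℕ → ℕ → K := fun t n => (-1) ^ t * z ^ (2 * (t + n)) *
    q ^ ((t + n) ^ 2 + (t + n) + n ^ 2) * invPoch q t * invPoch q ((L : ℤ) - 2 * (t + n)) *
      qPoch (q ^ 2) (q ^ 2) (L - (t + n)) * invPoch (q ^ 2) n
  have h1 : ∀ i ∈ Finset.range (L + 1), ∀ j ∈ Finset.range (L + 1),
      ∑ k ∈ Finset.range (L + 1), tripleTerm q z L i j k =
        ∑ t ∈ Finset.range (L + 1), f t i j := by
    intro i hi j hj
    rw [Finset.mem_range] at hi hj
    have hk : ∀ k ∈ Finset.range (L + 1), tripleTerm q z L i j k =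
        ∑ t ∈ Finset.range (L + 1), c i j * (q ^ ((i - t) * (j - t)) * invPoch q t *
          invPoch q ((i : ℤ) - t) * invPoch q ((j : ℤ) - t) *
            (q ^ triangular k * invPoch q k * invPoch q ((L : ℤ) - j - (i - t) - k))) := by
      intro k hk
      rw [Finset.mem_range] at hk
      have hv := sum_antidiagonal_vandermonde hq (L - k) i j
      rw [Finset.Nat.sum_antidiagonal_eq_sum_range_succ_mk,
        Nat.cast_sub (by omega : k ≤ L)] at hv
      -- Regrouping the nine factorials of the three `q`-binomials exposes the right-hand side of
      -- Vandermonde with `M = L - k`.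
      have ht : tripleTerm q z L i j k = c i j * (q ^ triangular k * invPoch q k) *
          (qPoch q q (L - k) * invPoch q i * invPoch q j * invPoch q ((L : ℤ) - k - i) *
            invPoch q ((L : ℤ) - k - j)) := by
        simp only [c]
        rw [tripleTerm, qBinom_eq_invPoch hq, qBinom_eq_invPoch hq, qBinom_eq_invPoch hq,
          show ((L : ℤ) - i).toNat = L - i by omega, show ((L : ℤ) - j).toNat = L - j by omega,
          show ((L : ℤ) - k).toNat = L - k by omega,
          show (L : ℤ) - j - k = L - k - j by ring]
        ring
      rw [ht, ← hv, Finset.mul_sum, sum_range_extend (by omega : i + 1 ≤ L + 1)]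
      · refine Finset.sum_congr rfl fun t ht => ?_
        rw [Finset.mem_range] at ht
        simp only
        rw [Nat.cast_sub (by omega : t ≤ i),
          show (L : ℤ) - k - j - (i - t) = L - j - (i - t) - k by ring]
        ring
      · intro t ht
        rw [invPoch_of_neg q (n := (i : ℤ) - t) (by omega)]
        ring
    rw [Finset.sum_congr rfl hk, Finset.sum_comm]
    refine Finset.sum_congr rfl fun t _ => ?_
    simp only [← Finset.mul_sum, f]
    by_cases htj : t ≤ j
    · by_cases hti : t ≤ i
      · rw [sum_range_triangular_mul_invPoch hq L _ (by omega)]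
      · rw [invPoch_of_neg q (n := (i : ℤ) - t) (by omega)]
        ring
    · rw [invPoch_of_neg q (n := (j : ℤ) - t) (by omega)]
      ring
  have h2 : ∀ t ∈ Finset.range (L + 1), ∀ w ∈ Finset.range (L + 1),
      ∑ p ∈ Finset.HasAntidiagonal.antidiagonal w, f t (p.1 + t) (p.2 + t) =
        if Even w then h t (w / 2) else 0 := by
    intro t _ w _
    rcases le_or_gt (2 * t + w) L with hL | hL
    · obtain ⟨d, rfl⟩ := Nat.exists_eq_add_of_le hL
      -- The Vandermonde power `q^(p.1 * p.2)` completes `T_{p.1} + T_{p.2}` to `T_w`, so the power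
      -- of `q` depends only on `t` and `w` and leaves the sum.
      have hp : ∀ p ∈ Finset.HasAntidiagonal.antidiagonal w, f t (p.1 + t) (p.2 + t) =
          (-1) ^ t * z ^ (w + 2 * t) * q ^ (triangular w + 2 * triangular t + t * w) *
            invPoch q d * invPoch q t * (qPoch (-q) q (t + d) * invPoch q (t + d : ℕ)) *
          ((-1) ^ p.2 * qPoch q q (p.2 + (t + d)) * qPoch q q (p.1 + (t + d)) *
            invPoch q p.1 * invPoch q p.2) := by
        intro p hp
        obtain rfl := Finset.HasAntidiagonal.mem_antidiagonal.1 hp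
        simp only [f, c, Nat.add_sub_cancel]
        rw [show ((2 * t + (p.1 + p.2) + d : ℕ) : ℤ) - ((p.1 + t : ℕ) : ℤ) -
            ((p.2 + t : ℕ) : ℤ) = d by push_cast; ring,
          show ((2 * t + (p.1 + p.2) + d : ℕ) : ℤ) - ((p.2 + t : ℕ) : ℤ) -
            (((p.1 + t : ℕ) : ℤ) - t) = (t + d : ℕ) by push_cast; ring, Int.toNat_natCast,
          show 2 * t + (p.1 + p.2) + d - (p.1 + t) = p.2 + (t + d) by omega,
          show 2 * t + (p.1 + p.2) + d - (p.2 + t) = p.1 + (t + d) by omega,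
          show ((p.1 + t : ℕ) : ℤ) - t = p.1 by push_cast; ring,
          show ((p.2 + t : ℕ) : ℤ) - t = p.2 by push_cast; ring,
          Nat.cast_add, Nat.cast_add, Nat.cast_add p.1 p.2, triangular_add, triangular_add,
          triangular_add]
        ring
      rw [Finset.sum_congr rfl hp, ← Finset.mul_sum, sum_antidiagonal_wellPoised hq]
      by_cases hw : Even w
      · obtain ⟨n, rfl⟩ := hw
        have hn : Even (n + n) := ⟨n, rfl⟩
        have e1 := qPoch_neg_mul q (t + d)
        have e2 := qPoch_mul_invPoch hq (t + d)
        have e3 := qPoch_mul_invPoch hq.sq (t + d)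
        simp only [hn, if_true, h]
        rw [show (n + n) / 2 = n by omega,
          show ((2 * t + (n + n) + d : ℕ) : ℤ) - 2 * (t + n) = d by push_cast; ring,
          show 2 * t + (n + n) + d - (t + n) = n + (t + d) by omega,
          show triangular ((n + n : ℕ) : ℤ) + 2 * triangular t + t * (n + n) =
            (t + n) ^ 2 + (t + n) + n ^ 2 by
              rw [two_mul_triangular, Nat.cast_add, triangular_add, ← two_mul,
                two_mul_triangular]
              ring]
        -- The factors left by the `k`-sum and by the well-poised sum cancel, since `(-q; q)_s (q;
        -- q)_s = (q²; q²)_s`.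
        have e : qPoch (-q) q (t + d) * invPoch q (t + d : ℕ) *
            (qPoch q q (t + d) ^ 2 * invPoch (q ^ 2) (t + d : ℕ)) = 1 := by
          rw [← e3, ← e1]
          linear_combination (qPoch (-q) q (t + d) * qPoch q q (t + d) *
            invPoch (q ^ 2) (t + d : ℕ)) * e2
        linear_combination ((-1) ^ t * z ^ (2 * (t + n)) *
          q ^ ((t + n) ^ 2 + (t + n) + n ^ 2) * invPoch q d * invPoch q t *
            qPoch (q ^ 2) (q ^ 2) (n + (t + d)) * invPoch (q ^ 2) n) * e
      · simp only [hw, if_false, mul_zero]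
    · rw [Finset.sum_eq_zero]
      · by_cases hw : Even w
        · obtain ⟨n, rfl⟩ := hw
          simp only [h]
          rw [invPoch_of_neg q (n := (L : ℤ) - 2 * _) (by omega)]
          simp
        · rw [if_neg hw]
      · intro p hp
        have := Finset.HasAntidiagonal.mem_antidiagonal.1 hp
        simp only [f, c]
        rw [invPoch_of_neg q (n := (L : ℤ) - _ - ((p.2 + t : ℕ) : ℤ)) (by omega)]
        ring
  calc _ = ∑ t ∈ Finset.range (L + 1), ∑ i ∈ Finset.range (L + 1),
        ∑ j ∈ Finset.range (L + 1), f t i j := by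
        rw [Finset.sum_comm (s := Finset.range (L + 1)) (t := Finset.range (L + 1))
          (f := fun t i => ∑ j ∈ Finset.range (L + 1), f t i j)]
        refine Finset.sum_congr rfl fun i hi => ?_
        rw [Finset.sum_congr rfl (h1 i hi), Finset.sum_comm]
    _ = ∑ t ∈ Finset.range (L + 1), ∑ n ∈ Finset.range (L + 1), h t n := by
        refine Finset.sum_congr rfl fun t ht => ?_
        rw [sum_range_sum_range_shift (L + 1) t, Finset.sum_congr rfl (h2 t ht),
          sum_range_even]
        · intro n hn
          simp only [h]
          rw [invPoch_of_neg q (n := (L : ℤ) - 2 * _) (by omega)]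
          ring
        · intro i j hi
          simp only [f]
          rw [invPoch_of_neg q (n := (i : ℤ) - t) (by omega)]
          ring
        · intro i j hj
          simp only [f]
          rw [invPoch_of_neg q (n := (j : ℤ) - t) (by omega)]
          ring
        · intro i j hij
          simp only [f, c]
          rw [invPoch_of_neg q (n := (L : ℤ) - i - j) (by omega)]
          ring
    _ = _ := by
        -- Grouping by `m = t + n` leaves `(-1)^t q^(n²) / ((q; q)_t (q²; q²)_n)` as the only part
        -- varying along an antidiagonal.
        rw [sum_range_sum_range]
        · refine Finset.sum_congr rfl fun m _ => ?_
          rw [commonTerm, ← sum_antidiagonal_neg_one_pow_mul_sq hq m,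
            ← Finset.Nat.sum_antidiagonal_swap, Finset.mul_sum, Finset.sum_mul, Finset.sum_mul]
          refine Finset.sum_congr rfl fun p hp => ?_
          obtain rfl := Finset.HasAntidiagonal.mem_antidiagonal.1 hp
          simp only [h, Prod.fst_swap, Prod.snd_swap]
          have e : (-1 : K) ^ p.2 = (-1) ^ (p.1 + p.2) * (-1) ^ p.1 := by
            rw [pow_add, mul_right_comm, ← mul_pow]; simp
          rw [e, add_comm p.2 p.1, show (p.2 : ℤ) + p.1 = ((p.1 + p.2 : ℕ) : ℤ) by push_cast; ring,
            neg_pow (z ^ 2), ← pow_mul, pow_add q (_ + _)]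
          ring
        · intro t n hn
          simp only [h]
          rw [invPoch_of_neg q (n := (L : ℤ) - 2 * _) (by omega)]
          ring

end Field

/-! ### Transfer to arbitrary commutative rings. -/

theorem map_qPoch {R S : Type*} [CommRing R] [CommRing S] (φ : R →+* S) (a q : R) (n : ℕ) :
    φ (qPoch a q n) = qPoch (φ a) (φ q) n := by
  simp [qPoch, map_prod]

theorem map_qBinom {R S : Type*} [CommRing R] [CommRing S] (φ : R →+* S) (q : R) (a b : ℤ) :
    φ (qBinom q a b) = qBinom (φ q) a b := by
  unfold qBinom
  split_ifs
  · exact (aeval_algHom_apply φ.toIntAlgHom q _).symm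
  · exact map_zero φ

theorem map_singleTerm {R S : Type*} [CommRing R] [CommRing S] (φ : R →+* S) (q z : R)
    (L j : ℕ) : φ (singleTerm q z L j) = singleTerm (φ q) (φ z) L j := by
  simp [singleTerm, map_qPoch, map_qBinom]

theorem map_tripleTerm {R S : Type*} [CommRing R] [CommRing S] (φ : R →+* S) (q z : R)
    (L i j k : ℕ) : φ (tripleTerm q z L i j k) = tripleTerm (φ q) (φ z) L i j k := by
  simp [tripleTerm, map_qBinom]

theorem sum_singleTerm_eq_sum_tripleTerm {R : Type*} [CommRing R] (q z : R) (L : ℕ) :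
    ∑ j ∈ Finset.range (L + 1), singleTerm q z L j =
      ∑ i ∈ Finset.range (L + 1), ∑ j ∈ Finset.range (L + 1), ∑ k ∈ Finset.range (L + 1),
        tripleTerm q z L i j k := by
  let A := MvPolynomial (Fin 2) ℤ
  let K := FractionRing A
  let ι : A →+* K := algebraMap A K
  have hι : Function.Injective ι := IsFractionRing.injective A K
  -- A relation `1 - X^(n+1) = 0` would become `1 = 0` on evaluation at `0`.
  have hq : QGeneric (ι (MvPolynomial.X 0)) := by
    intro n hn
    rw [← map_pow, ← map_one ι, ← map_sub, map_eq_zero_iff ι hι] at hn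
    have h := congrArg (MvPolynomial.eval fun _ => (0 : ℤ)) hn
    simp at h
  have key : ∑ j ∈ Finset.range (L + 1),
      singleTerm (MvPolynomial.X 0 : A) (MvPolynomial.X 1) L j =
      ∑ i ∈ Finset.range (L + 1), ∑ j ∈ Finset.range (L + 1), ∑ k ∈ Finset.range (L + 1),
        tripleTerm (MvPolynomial.X 0 : A) (MvPolynomial.X 1) L i j k := by
    apply hι
    simp only [map_sum, map_singleTerm, map_tripleTerm]
    rw [sum_singleTerm hq, sum_tripleTerm hq]
  -- The identity over `ℤ[q, z]` is universal and specialises to any `q`, `z`.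
  have h := congrArg (MvPolynomial.eval₂Hom (Int.castRingHom R) ![q, z]) key
  simpa only [map_sum, map_singleTerm, map_tripleTerm, MvPolynomial.eval₂Hom_X',
    Matrix.cons_val_zero, Matrix.cons_val_one] using h

theorem qBinom_of_lt {R : Type*} [CommRing R] (q : R) {a b : ℤ} (h : a < b) :
    qBinom q a b = 0 := if_neg (by omega)

/-- In every commutative ring, for all `q`, `z` and every `L ≥ 0`: both sums have only finitely
many nonzero terms, and they are equal. -/
theorem mainTheorem6 {R : Type*} [CommRing R] (q z : R) (L : ℕ) :
    (Function.support fun j : ℕ => singleTerm q z L j).Finite ∧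
    (Function.support fun p : ℕ × ℕ × ℕ => tripleTerm q z L p.1 p.2.1 p.2.2).Finite ∧
    ∑ᶠ j : ℕ, singleTerm q z L j =
      ∑ᶠ p : ℕ × ℕ × ℕ, tripleTerm q z L p.1 p.2.1 p.2.2 := by
  have h1 : (Function.support fun j : ℕ => singleTerm q z L j) ⊆
      (Finset.range (L + 1) : Finset ℕ) := by
    intro j hj
    rw [Finset.mem_coe, Finset.mem_range]
    by_contra h
    refine hj ?_
    simp only [singleTerm]
    rw [qBinom_of_lt q (by omega), mul_zero]
  have h2 : (Function.support fun p : ℕ × ℕ × ℕ => tripleTerm q z L p.1 p.2.1 p.2.2) ⊆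
      (Finset.range (L + 1) ×ˢ Finset.range (L + 1) ×ˢ Finset.range (L + 1) :
        Finset (ℕ × ℕ × ℕ)) := by
    rintro ⟨i, j, k⟩ hp
    simp only [Finset.mem_coe, Finset.mem_product, Finset.mem_range]
    by_contra h
    refine hp ?_
    simp only [tripleTerm]
    -- If `i + j > L` the first `q`-binomial vanishes; otherwise `i, j ≤ L`, so `k > L` and the
    -- second one vanishes.
    by_cases hij : L < i + j
    · rw [qBinom_of_lt q (a := (L : ℤ) - i) (by omega)]
      ring
    · rw [qBinom_of_lt q (a := (L : ℤ) - j) (by omega)]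
      ring
  refine ⟨(Finset.finite_toSet _).subset h1, (Finset.finite_toSet _).subset h2, ?_⟩
  rw [finsum_eq_sum_of_support_subset _ h1, finsum_eq_sum_of_support_subset _ h2,
    sum_singleTerm_eq_sum_tripleTerm, Finset.sum_product]
  exact Finset.sum_congr rfl fun i _ => by rw [Finset.sum_product]
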